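/- Let $n, m \geqslant 1$. Let $W\in\mathbb R^{n\times n}$ be a kernel denoiser, i.e. $W_{ij}=K_{ij}/\sum_{l}K_{il}$ for some symmetric positive semidefinite matrix $K\in\mathbb R^{n\times n}$ with nonnegative entries that is primitive (there is $p\geqslant 1$ such that all entries of $K^p$ are positive). Let $A\in\mathbb R^{m\times n}$ be a nonzero matrix of one of the following types: - inpainting: $m=n$ and $A$ is a diagonal matrix with diagonal entries in $\{0,1\}$; - deblurring: $m=n$ and $A$ is a circulant matrix with nonnegative entries whose rows sum to $1$; - superresolution: $A=SH$, where $H\in\mathbb R^{n\times n}$ is a circulant matrix with nonnegative entries whose rows sum to $1$, and the rows of $S\in\mathbb R^{m\times n}$ are $m$ distinct rows of the $n\times n$ identity matrix. Put $B=A^\top A$ and $P(t)=W(I-tB)$. Then there exists $T>0$ (depending only on $W$ and $A$) such that for every step size $0<t<T$, every $b\in\mathbb R^m$ and every initial point $x^{(0)}\in\mathbb R^n$, the plug-and-play iterations $$x^{(k+1)}=P(t)\,x^{(k)}+t\,WA^\top b,\qquad k\geqslant 0,$$ converge in $\mathbb R^n$ as $k\to\infty$. -/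

import Mathlib

open Filter Topology Matrix

/-- `W` is a kernel denoiser: `W` is obtained by row-normalizing a nonnegative, primitive,
positive semidefinite kernel matrix `K`. (`Matrix.IsPrimitive` contains entrywise
nonnegativity, and `Matrix.PosSemidef` contains symmetry.) -/
def IsKernelDenoiser {n : ℕ} (W : Matrix (Fin n) (Fin n) ℝ) : Prop :=
  ∃ K : Matrix (Fin n) (Fin n) ℝ,
    K.IsPrimitive ∧ K.PosSemidef ∧ ∀ i j, W i j = K i j / ∑ l, K i l

/-- Inpainting: `A` is a diagonal matrix with diagonal entries in `{0, 1}`. -/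
def IsInpainting {n : ℕ} (A : Matrix (Fin n) (Fin n) ℝ) : Prop :=
  ∃ d : Fin n → ℝ, (∀ i, d i = 0 ∨ d i = 1) ∧ A = Matrix.diagonal d

/-- Deblurring: `A` is a circulant (row-)stochastic matrix. -/
def IsDeblurring {n : ℕ} (A : Matrix (Fin n) (Fin n) ℝ) : Prop :=
  A ∈ Matrix.rowStochastic ℝ (Fin n) ∧ ∃ h : Fin n → ℝ, A = Matrix.circulant h

/-- Subsampling: `S` is formed by `m` (distinct) rows of the `n × n` identity matrix. -/
def IsSubsampling {m n : ℕ} (S : Matrix (Fin m) (Fin n) ℝ) : Prop :=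
  ∃ f : Fin m → Fin n, Function.Injective f ∧
    S = (1 : Matrix (Fin n) (Fin n) ℝ).submatrix f id

/-- Superresolution: `A = S H` with a subsampling matrix `S` and a deblurring operator `H`. -/
def IsSuperresolution {m n : ℕ} (A : Matrix (Fin m) (Fin n) ℝ) : Prop :=
  ∃ (S : Matrix (Fin m) (Fin n) ℝ) (H : Matrix (Fin n) (Fin n) ℝ),
    IsSubsampling S ∧ IsDeblurring H ∧ A = S * H

/-- The forward operators: inpainting, deblurring (where `m = n`) and superresolution. -/
inductive IsForwardOperator {n : ℕ} : (m : ℕ) → Matrix (Fin m) (Fin n) ℝ → Prop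
  | inpainting (A : Matrix (Fin n) (Fin n) ℝ) (hA : IsInpainting A) : IsForwardOperator n A
  | deblurring (A : Matrix (Fin n) (Fin n) ℝ) (hA : IsDeblurring A) : IsForwardOperator n A
  | superresolution (m : ℕ) (A : Matrix (Fin m) (Fin n) ℝ) (hA : IsSuperresolution A) :
      IsForwardOperator m A

/-- The matrix `P(t) = W (I - t B)`. -/
def pnpMatrix {n : ℕ} (W B : Matrix (Fin n) (Fin n) ℝ) (t : ℝ) : Matrix (Fin n) (Fin n) ℝ :=
  W * (1 - t • B)

/-- `x` is a sequence of plug-and-play iterations with denoiser `W`, forward operator `A`,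
observation `b` and step size `t`: `x (k+1) = P(t) x k + t W Aᵀ b`, where `B = Aᵀ A`. The
initial point `x 0` is arbitrary. -/
def IsPnPIteration {m n : ℕ} (W : Matrix (Fin n) (Fin n) ℝ) (A : Matrix (Fin m) (Fin n) ℝ)
    (b : Fin m → ℝ) (t : ℝ) (x : ℕ → Fin n → ℝ) : Prop :=
  ∀ k, x (k + 1) = pnpMatrix W (Aᵀ * A) t *ᵥ x k + t • ((W * Aᵀ) *ᵥ b)

/-! Weight coordinates by the row sums `d` of `K`. Then `W` is self-adjoint, fixes the vector `1`,
preserves the weighted mean `π` and, since `K` is positive semidefinite and primitive, strictly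
shrinks the weighted norm on `ker π`. Subtracting `t W B` moves the simple eigenvalue 1 to first
order by `-t π (W B 1) = -t π (B 1)`, which is negative because `A` is nonnegative and nonzero. No
spectral theory is needed: `exists_contracting_functional` builds `N x = |π x| + κ ‖φ (x - π x •
e)‖`, which `P(t)` contracts for all small `t`, and the iterates are then Cauchy. -/

/-! ### Perturbing a simple eigenvalue 1 -/

section Perturbation

variable {V E : Type*} [NormedAddCommGroup V] [NormedSpace ℝ V] [FiniteDimensional ℝ V]
  [NormedAddCommGroup E] [NormedSpace ℝ E]

/-- A linear map that strictly decreases a norm on the kernel of a functional decreases it by a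
uniform factor there. -/
theorem exists_uniform_contraction_on_ker (φ : V →L[ℝ] E) (hφ : Function.Injective φ)
    (π : V →L[ℝ] ℝ) (W : V →L[ℝ] V)
    (hW : ∀ y, π y = 0 → y ≠ 0 → ‖φ (W y)‖ < ‖φ y‖) :
    ∃ ρ : ℝ, 0 ≤ ρ ∧ ρ < 1 ∧ ∀ y, π y = 0 → ‖φ (W y)‖ ≤ ρ * ‖φ y‖ := by
  have hpos : ∀ y, y ≠ 0 → 0 < ‖φ y‖ := fun y hy =>
    norm_pos_iff.2 fun h => hy (hφ (by simpa using h))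
  let S : Set V := Metric.sphere 0 1 ∩ {y | π y = 0}
  have hS0 : ∀ y ∈ S, y ≠ 0 := by
    rintro y ⟨hy, -⟩ rfl
    simp at hy
  have hSc : IsCompact S :=
    (isCompact_sphere 0 1).inter_right (isClosed_eq π.continuous continuous_const)
  have key : ∃ ρ : ℝ, 0 ≤ ρ ∧ ρ < 1 ∧ ∀ y ∈ S, ‖φ (W y)‖ ≤ ρ * ‖φ y‖ := by
    rcases S.eq_empty_or_nonempty with hS | hS
    · exact ⟨0, le_rfl, zero_lt_one, by simp [hS]⟩
    · have hc : ContinuousOn (fun y => ‖φ (W y)‖ / ‖φ y‖) S :=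
        ContinuousOn.div (by fun_prop) (by fun_prop) fun y hy => (hpos y (hS0 y hy)).ne'
      obtain ⟨z, hz, hmax⟩ := hSc.exists_isMaxOn hS hc
      refine ⟨‖φ (W z)‖ / ‖φ z‖, by positivity,
        (div_lt_one (hpos z (hS0 z hz))).2 (hW z hz.2 (hS0 z hz)), fun y hy => ?_⟩
      rw [← div_le_iff₀ (hpos y (hS0 y hy))]
      exact hmax hy
  obtain ⟨ρ, h0, h1, h⟩ := key
  refine ⟨ρ, h0, h1, fun y hy => ?_⟩
  rcases eq_or_ne y 0 with rfl | hy0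
  · simp
  have hn : 0 < ‖y‖ := norm_pos_iff.2 hy0
  have := h (‖y‖⁻¹ • y) ⟨by simp [norm_smul, hn.ne'], by simp [hy]⟩
  simp only [map_smul, norm_smul, norm_inv, norm_norm] at this
  rw [mul_left_comm] at this
  exact le_of_mul_le_mul_left this (by positivity)

theorem exists_norm_le_of_injective (φ : V →L[ℝ] E) (hφ : Function.Injective φ) :
    ∃ C : ℝ, 0 < C ∧ ∀ y, ‖y‖ ≤ C * ‖φ y‖ := by
  obtain ⟨C, hC, h⟩ := LinearMap.exists_antilipschitzWith (φ : V →ₗ[ℝ] E)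
    (LinearMap.ker_eq_bot.2 hφ)
  exact ⟨C, hC, fun y => by simpa using h.le_mul_dist y 0⟩

/-- If `W` fixes `e`, preserves the functional `π` and strictly contracts the kernel of `π`, then
a small perturbation `W - t L` with `π (L e) > 0` contracts a functional equivalent to the norm. -/
theorem exists_contracting_functional (φ : V →L[ℝ] E) (hφ : Function.Injective φ)
    (π : V →L[ℝ] ℝ) (e : V) (he : π e = 1) (W L : V →L[ℝ] V) (hWe : W e = e)
    (hπW : ∀ x, π (W x) = π x) (hW : ∀ y, π y = 0 → y ≠ 0 → ‖φ (W y)‖ < ‖φ y‖)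
    (hL : 0 < π (L e)) :
    ∃ T : ℝ, 0 < T ∧ ∃ N : V → ℝ, ∃ C : ℝ, 0 < C ∧ (∀ x, ‖x‖ ≤ C * N x) ∧
      ∀ t, 0 < t → t < T → ∃ q : ℝ, 0 ≤ q ∧ q < 1 ∧ ∀ x, N (W x - t • L x) ≤ q * N x := by
  obtain ⟨ρ, hρ0, hρ1, hρ⟩ := exists_uniform_contraction_on_ker φ hφ π W hW
  obtain ⟨C, hC, hCφ⟩ := exists_norm_le_of_injective φ hφ
  set c := π (L e) with hc
  -- The part of `L` that lands in `ker π`, read through `φ`.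
  let F : V →L[ℝ] E := φ ∘L (L - (π ∘L L).smulRight e)
  have hF : ∀ x, F x = φ (L x - π (L x) • e) := fun x => by simp [F]
  let M : ℝ := ‖π ∘L L‖ * C + ‖F‖ * C + ‖F e‖ + 1
  have hM : 0 < M := by positivity
  have hM1 : ∀ y, |π (L y)| ≤ M * ‖φ y‖ := fun y => by
    have h1 : |π (L y)| ≤ ‖π ∘L L‖ * ‖y‖ := (π ∘L L).le_opNorm y
    have h2 : ‖π ∘L L‖ * ‖y‖ ≤ ‖π ∘L L‖ * (C * ‖φ y‖) := by gcongr; exact hCφ y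
    have h3 : 0 ≤ (‖F‖ * C + ‖F e‖ + 1) * ‖φ y‖ := by positivity
    simp only [M]; linarith
  have hM2 : ∀ y, ‖F y‖ ≤ M * ‖φ y‖ := fun y => by
    have h1 : ‖F y‖ ≤ ‖F‖ * ‖y‖ := F.le_opNorm y
    have h2 : ‖F‖ * ‖y‖ ≤ ‖F‖ * (C * ‖φ y‖) := by gcongr; exact hCφ y
    have h3 : 0 ≤ (‖π ∘L L‖ * C + ‖F e‖ + 1) * ‖φ y‖ := by positivity
    simp only [M]; linarith
  have hM3 : ‖F e‖ ≤ M := by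
    have : 0 ≤ ‖π ∘L L‖ * C + ‖F‖ * C := by positivity
    simp only [M]; linarith
  -- The mean leaks at most `t κ M |π x|` into the second term of `N`; this `κ` makes that half of
  -- the gain `t c |π x|`.
  let κ : ℝ := c / (2 * M)
  have hκ : 0 < κ := by positivity
  have hκM : κ * M = c / 2 := by simp only [κ]; field_simp
  have hρ' : 0 < 1 - ρ := by linarith
  -- The first bound keeps `1 - t c` positive; the second keeps the factor on `ker π`, `ρ + t (M + c
  -- / 2) / κ`, below 1.
  refine ⟨min (1 / c) (κ * (1 - ρ) / (M + c / 2)), by positivity,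
    fun x => |π x| + κ * ‖φ (x - π x • e)‖, ‖e‖ + C / κ, by positivity, fun x => ?_,
    fun t ht htT => ?_⟩
  · have h1 : ‖x‖ ≤ ‖π x • e‖ + ‖x - π x • e‖ := by
      simpa using norm_add_le (π x • e) (x - π x • e)
    have h2 := hCφ (x - π x • e)
    rw [norm_smul, Real.norm_eq_abs] at h1
    have h3 : C / κ * (κ * ‖φ (x - π x • e)‖) = C * ‖φ (x - π x • e)‖ := by field_simp
    have h4 : 0 ≤ ‖e‖ * (κ * ‖φ (x - π x • e)‖) := by positivity
    have h5 : 0 ≤ C / κ * |π x| := by positivity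
    linarith
  · have ht1 : t * c < 1 := (lt_div_iff₀ hL).1 (htT.trans_le (min_le_left _ _))
    have ht2 : t * (M + c / 2) < κ * (1 - ρ) :=
      (lt_div_iff₀ (by positivity)).1 (htT.trans_le (min_le_right _ _))
    refine ⟨max (1 - t * c / 2) (ρ + t * (M + c / 2) / κ),
      le_max_of_le_right (by positivity), max_lt (by nlinarith) ?_, fun x => ?_⟩
    · have : t * (M + c / 2) / κ < 1 - ρ := (div_lt_iff₀ hκ).2 (by linarith)
      linarith
    set a := π x with ha
    set y := x - a • e with hy
    have hx : x = a • e + y := by simp [hy]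
    have hπy : π y = 0 := by simp [hy, he, ha]
    have e1 : π (W x - t • L x) = (1 - t * c) * a - t * π (L y) := by
      rw [map_sub, hπW, map_smul, hx]
      simp only [map_add, map_smul, smul_eq_mul, hπy, he, ← hc]
      ring
    have e2 : φ (W x - t • L x - π (W x - t • L x) • e)
        = φ (W y) - t • (a • F e + F y) := by
      have : W x - t • L x - π (W x - t • L x) • e
          = W y - t • (a • (L e - π (L e) • e) + (L y - π (L y) • e)) := by
        rw [e1, hx]
        simp only [map_add, map_smul, hWe, ← hc]
        module
      rw [this, hF, hF]
      simp only [map_add, map_sub, map_smul]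
    have b1 : |π (W x - t • L x)| ≤ (1 - t * c) * |a| + t * (M * ‖φ y‖) := by
      rw [e1]
      refine (abs_sub _ _).trans ?_
      rw [abs_mul, abs_mul, abs_of_pos ht, abs_of_pos (by linarith : 0 < 1 - t * c)]
      gcongr
      exact hM1 y
    have b2 : ‖φ (W x - t • L x - π (W x - t • L x) • e)‖
        ≤ ρ * ‖φ y‖ + t * (|a| * M + M * ‖φ y‖) := by
      rw [e2]
      refine (norm_sub_le _ _).trans ?_
      rw [norm_smul, Real.norm_eq_abs, abs_of_pos ht]
      gcongr
      · exact hρ y hπy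
      · refine (norm_add_le _ _).trans ?_
        rw [norm_smul, Real.norm_eq_abs]
        gcongr
        exact hM2 y
    calc |π (W x - t • L x)| + κ * ‖φ (W x - t • L x - π (W x - t • L x) • e)‖
        ≤ ((1 - t * c) * |a| + t * (M * ‖φ y‖))
          + κ * (ρ * ‖φ y‖ + t * (|a| * M + M * ‖φ y‖)) := by gcongr
      _ = (1 - t * c + t * (κ * M)) * |a| + (t * M + κ * ρ + t * (κ * M)) * ‖φ y‖ := by ring
      _ = (1 - t * c / 2) * |a| + (ρ + t * (M + c / 2) / κ) * (κ * ‖φ y‖) := by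
        rw [hκM]; field_simp; ring
      _ ≤ _ := by
        refine (add_le_add (mul_le_mul_of_nonneg_right (le_max_left _ _) (abs_nonneg a))
          (mul_le_mul_of_nonneg_right (le_max_right _ _) (by positivity))).trans_eq
          (mul_add _ _ _).symm

end Perturbation

/-- The iterations of an affine map converge if its linear part contracts a functional that
dominates the norm. -/
theorem exists_tendsto_of_affine_contraction {V : Type*} [NormedAddCommGroup V] [CompleteSpace V]
    (P : V → V) (hP : ∀ x y, P (x - y) = P x - P y) (N : V → ℝ) (C q : ℝ) (hC : 0 < C)
    (hN : ∀ x, ‖x‖ ≤ C * N x) (hq0 : 0 ≤ q) (hq1 : q < 1) (hPN : ∀ x, N (P x) ≤ q * N x)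
    (v : V) (x : ℕ → V) (hx : ∀ k, x (k + 1) = P (x k) + v) :
    ∃ xlim, Tendsto x atTop (𝓝 xlim) := by
  have hd : ∀ k, N (x (k + 1) - x k) ≤ q ^ k * N (x 1 - x 0) := by
    intro k
    induction k with
    | zero => simp
    | succ k ih =>
      have : x (k + 1 + 1) - x (k + 1) = P (x (k + 1) - x k) := by
        rw [hP, ← sub_eq_of_eq_add (hx (k + 1)), ← sub_eq_of_eq_add (hx k)]
        abel
      rw [this, pow_succ', mul_assoc]
      exact (hPN _).trans (mul_le_mul_of_nonneg_left ih hq0)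
  refine cauchySeq_tendsto_of_complete
    (cauchySeq_of_le_geometric q (C * N (x 1 - x 0)) hq1 fun k => ?_)
  rw [dist_comm, dist_eq_norm]
  refine (hN _).trans ((mul_le_mul_of_nonneg_left (hd k) hC.le).trans_eq ?_)
  ring

/-! ### Weighted norm estimates for the normalized kernel -/

section Kernel

variable {n : ℕ} {K : Matrix (Fin n) (Fin n) ℝ}

theorem Matrix.IsPrimitive.row_sum_pos (hK : K.IsPrimitive) (i : Fin n) : 0 < ∑ l, K i l := by
  obtain ⟨p, hp, hpos⟩ := hK.exists_pos_pow
  refine (Finset.sum_nonneg fun l _ => hK.nonneg i l).lt_of_ne' fun h => ?_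
  have h0 : ∀ l, K i l = 0 := fun l =>
    (Finset.sum_eq_zero_iff_of_nonneg fun l _ => hK.nonneg i l).1 h l (Finset.mem_univ l)
  obtain ⟨k, rfl⟩ := Nat.exists_eq_succ_of_ne_zero hp.ne'
  have := hpos i i
  simp [pow_succ', Matrix.mul_apply, h0] at this

/-- The Dirichlet form of a symmetric kernel. -/
theorem sum_mul_sub_sq_eq (hs : ∀ i j, K i j = K j i) (y : Fin n → ℝ) :
    ∑ i, ∑ j, K i j * (y i - y j) ^ 2
      = 2 * (∑ i, (∑ l, K i l) * y i ^ 2 - ∑ i, ∑ j, y i * K i j * y j) := by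
  have h1 : ∑ i, ∑ j, K i j * y j ^ 2 = ∑ i, (∑ l, K i l) * y i ^ 2 := by
    rw [Finset.sum_comm]
    refine Finset.sum_congr rfl fun i _ => ?_
    rw [Finset.sum_mul]
    exact Finset.sum_congr rfl fun j _ => by rw [hs]
  have h2 : ∑ i, ∑ j, K i j * y i ^ 2 = ∑ i, (∑ l, K i l) * y i ^ 2 := by
    simp only [Finset.sum_mul]
  calc ∑ i, ∑ j, K i j * (y i - y j) ^ 2
      = ∑ i, ∑ j, K i j * y i ^ 2 + ∑ i, ∑ j, K i j * y j ^ 2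
        - 2 * ∑ i, ∑ j, y i * K i j * y j := by
        simp only [Finset.mul_sum, ← Finset.sum_add_distrib, ← Finset.sum_sub_distrib]
        exact Finset.sum_congr rfl fun i _ => Finset.sum_congr rfl fun j _ => by ring
    _ = _ := by rw [h1, h2]; ring

/-- Vectors that are constant along the edges of a primitive kernel are constant. -/
theorem Matrix.IsPrimitive.eq_of_forall_mul_eq (hK : K.IsPrimitive) (y : Fin n → ℝ)
    (hy : ∀ i j, K i j * (y i - y j) ^ 2 = 0) (i j : Fin n) : y i = y j := by
  -- `diagonal y` then commutes with every power of `K`, in particular with one whose entries are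
  -- all positive.
  have hcomm : Commute (Matrix.diagonal y) K := by
    ext a b
    rw [Matrix.diagonal_mul, Matrix.mul_diagonal]
    rcases mul_eq_zero.1 (hy a b) with h | h
    · simp [h]
    · rw [sub_eq_zero.1 (pow_eq_zero_iff two_ne_zero |>.1 h), mul_comm]
  obtain ⟨p, -, hpos⟩ := hK.exists_pos_pow
  have h := congrFun (congrFun (hcomm.pow_right p).eq i) j
  rw [Matrix.diagonal_mul, Matrix.mul_diagonal, mul_comm] at h
  exact mul_left_cancel₀ (hpos i j).ne' h

/-- The gap is half the Dirichlet form, which vanishes only on constants. -/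
theorem Matrix.IsPrimitive.quadratic_lt (hK : K.IsPrimitive) (hs : ∀ i j, K i j = K j i)
    (y : Fin n → ℝ) (hy : ∃ i j, y i ≠ y j) :
    ∑ i, ∑ j, y i * K i j * y j < ∑ i, (∑ l, K i l) * y i ^ 2 := by
  have h := sum_mul_sub_sq_eq hs y
  have hnn : ∀ i j, 0 ≤ K i j * (y i - y j) ^ 2 := fun i j =>
    mul_nonneg (hK.nonneg i j) (sq_nonneg _)
  suffices 0 < ∑ i, ∑ j, K i j * (y i - y j) ^ 2 by linarith
  refine (Finset.sum_nonneg fun i _ => Finset.sum_nonneg fun j _ => hnn i j).lt_of_ne' fun h0 => ?_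
  obtain ⟨i, j, hij⟩ := hy
  refine hij (hK.eq_of_forall_mul_eq y (fun a b => ?_) i j)
  have ha := (Finset.sum_eq_zero_iff_of_nonneg fun i _ =>
    Finset.sum_nonneg fun j _ => hnn i j).1 h0 a (Finset.mem_univ a)
  exact (Finset.sum_eq_zero_iff_of_nonneg fun j _ => hnn a j).1 ha b (Finset.mem_univ b)

theorem Matrix.PosSemidef.sum_nonneg (hK : K.PosSemidef) (x : Fin n → ℝ) :
    0 ≤ ∑ i, ∑ j, x i * K i j * x j := by
  have := hK.dotProduct_mulVec_nonneg x
  simpa [dotProduct, Matrix.mulVec, Finset.mul_sum, mul_assoc] using this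

/-- The normalized kernel does not increase the norm weighted by the row sums by more than the
quadratic form of the kernel. -/
theorem weighted_sq_normalized_le (hK : K.IsPrimitive) (hpsd : K.PosSemidef)
    (hs : ∀ i j, K i j = K j i) (y z : Fin n → ℝ)
    (hz : ∀ i, (∑ l, K i l) * z i = ∑ j, K i j * y j) :
    ∑ i, (∑ l, K i l) * z i ^ 2 ≤ ∑ i, ∑ j, y i * K i j * y j := by
  -- Expanding gives `0 ≤ ⟨y, K y⟩ - 2 ⟨z, K y⟩ + ⟨z, K z⟩`, where `⟨z, K y⟩` is the weighted square
  -- norm of `z` and `⟨z, K z⟩` is at most that.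
  have h0 := hpsd.sum_nonneg (y - z)
  have h1 : ∑ i, ∑ j, z i * K i j * y j = ∑ i, (∑ l, K i l) * z i ^ 2 := by
    refine Finset.sum_congr rfl fun i _ => ?_
    rw [pow_two, ← mul_assoc, hz, Finset.sum_mul]
    exact Finset.sum_congr rfl fun j _ => by ring
  have h1' : ∑ i, ∑ j, y i * K i j * z j = ∑ i, ∑ j, z i * K i j * y j := by
    rw [Finset.sum_comm]
    exact Finset.sum_congr rfl fun i _ => Finset.sum_congr rfl fun j _ => by rw [hs]; ring
  have h2 : ∑ i, ∑ j, z i * K i j * z j ≤ ∑ i, (∑ l, K i l) * z i ^ 2 := by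
    have h := sum_mul_sub_sq_eq hs z
    have : 0 ≤ ∑ i, ∑ j, K i j * (z i - z j) ^ 2 := Finset.sum_nonneg fun i _ =>
      Finset.sum_nonneg fun j _ => mul_nonneg (hK.nonneg i j) (sq_nonneg _)
    linarith
  have h3 : ∑ i, ∑ j, (y - z) i * K i j * (y - z) j
      = ∑ i, ∑ j, y i * K i j * y j - ∑ i, ∑ j, z i * K i j * y j
        - ∑ i, ∑ j, y i * K i j * z j + ∑ i, ∑ j, z i * K i j * z j := by
    simp only [← Finset.sum_add_distrib, ← Finset.sum_sub_distrib, Pi.sub_apply]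
    exact Finset.sum_congr rfl fun i _ => Finset.sum_congr rfl fun j _ => by ring
  linarith

end Kernel

/-! ### Forward operators -/

theorem IsDeblurring.nonneg {n : ℕ} {A : Matrix (Fin n) (Fin n) ℝ} (hA : IsDeblurring A)
    (i j : Fin n) : 0 ≤ A i j :=
  hA.1.1 i j

/-- Besides `A ≠ 0`, this is all that convergence requires of the forward operator. -/
theorem IsForwardOperator.nonneg {m n : ℕ} {A : Matrix (Fin m) (Fin n) ℝ}
    (hA : IsForwardOperator m A) (i : Fin m) (j : Fin n) : 0 ≤ A i j := by
  cases hA with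
  | inpainting A hA =>
    obtain ⟨d, hd, rfl⟩ := hA
    rw [Matrix.diagonal_apply]
    split_ifs
    · rcases hd i with h | h <;> simp [h]
    · exact le_rfl
  | deblurring A hA => exact hA.nonneg i j
  | superresolution m A hA =>
    obtain ⟨S, H, ⟨f, -, rfl⟩, hH, rfl⟩ := hA
    rw [Matrix.mul_apply]
    refine Finset.sum_nonneg fun l _ => mul_nonneg ?_ (hH.nonneg l j)
    rw [Matrix.submatrix_apply, Matrix.one_apply]
    split_ifs <;> norm_num

/-- The quantity equals `⟨A d, A 1⟩`, a sum of nonnegative terms; a row with a positive entry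
contributes a positive one. Up to normalization it is the first-order drop of the eigenvalue 1. -/
theorem sum_mul_gram_mulVec_one_pos {m n : ℕ} {A : Matrix (Fin m) (Fin n) ℝ}
    (hA : ∀ i j, 0 ≤ A i j) (hA0 : A ≠ 0) (d : Fin n → ℝ) (hd : ∀ i, 0 < d i) :
    0 < d ⬝ᵥ ((Aᵀ * A) *ᵥ 1) := by
  have h : d ⬝ᵥ ((Aᵀ * A) *ᵥ 1) = ∑ i, (∑ j, A i j * d j) * ∑ j, A i j := by
    rw [← Matrix.mulVec_mulVec, Matrix.dotProduct_mulVec, Matrix.vecMul_transpose]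
    simp [dotProduct, Matrix.mulVec]
  have hex : ∃ i j, 0 < A i j := by
    by_contra! hcon
    exact hA0 (by ext i j; exact le_antisymm (hcon i j) (hA i j))
  obtain ⟨i, j, hij⟩ := hex
  rw [h]
  refine Finset.sum_pos' (fun i _ => mul_nonneg
    (Finset.sum_nonneg fun j _ => mul_nonneg (hA i j) (hd j).le)
    (Finset.sum_nonneg fun j _ => hA i j)) ⟨i, Finset.mem_univ i, mul_pos ?_ ?_⟩
  · exact Finset.sum_pos' (fun j _ => mul_nonneg (hA i j) (hd j).le)
      ⟨j, Finset.mem_univ j, mul_pos hij (hd j)⟩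
  · exact Finset.sum_pos' (fun j _ => hA i j) ⟨j, Finset.mem_univ j, hij⟩

theorem mainTheorem7 {m n : ℕ} (W : Matrix (Fin n) (Fin n) ℝ) (hW : IsKernelDenoiser W)
    (A : Matrix (Fin m) (Fin n) ℝ) (hA : IsForwardOperator m A) (hA0 : A ≠ 0) :
    ∃ T : ℝ, 0 < T ∧ ∀ t : ℝ, 0 < t → t < T →
      ∀ (b : Fin m → ℝ) (x : ℕ → Fin n → ℝ), IsPnPIteration W A b t x →
        ∃ xlim : Fin n → ℝ, Tendsto x atTop (𝓝 xlim) := by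
  obtain ⟨K, hK, hpsd, hWK⟩ := hW
  set d : Fin n → ℝ := fun i => ∑ l, K i l with hd
  have hdpos : ∀ i, 0 < d i := hK.row_sum_pos
  have hs : ∀ i j, K i j = K j i := fun i j => by simpa using (hpsd.1.apply i j).symm
  have hn : Nonempty (Fin n) := by
    by_contra hcon
    rw [not_nonempty_iff] at hcon
    exact hA0 (Subsingleton.elim _ _)
  have hsum : 0 < ∑ i, d i := Finset.sum_pos (fun i _ => hdpos i) Finset.univ_nonempty
  have hdW : ∀ i j, d i * W i j = K i j := fun i j => by
    rw [hWK]
    exact mul_div_cancel₀ _ (hdpos i).ne'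
  have hdWv : ∀ (v : Fin n → ℝ) i, d i * (W *ᵥ v) i = ∑ j, K i j * v j := fun v i => by
    simp only [Matrix.mulVec, dotProduct, Finset.mul_sum, ← mul_assoc, hdW]
  have hdW' : ∀ v, d ⬝ᵥ (W *ᵥ v) = d ⬝ᵥ v := fun v => by
    simp only [dotProduct, hdWv]
    rw [Finset.sum_comm]
    refine Finset.sum_congr rfl fun j _ => ?_
    rw [← Finset.sum_mul]
    simp only [hd, hs _ j]
  have hW1 : W *ᵥ 1 = 1 := by
    ext i
    refine mul_left_cancel₀ (hdpos i).ne' ?_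
    rw [hdWv]
    simp [hd]
  let π : (Fin n → ℝ) →L[ℝ] ℝ :=
    LinearMap.toContinuousLinearMap ((∑ i, d i)⁻¹ • dotProductBilin ℝ ℝ d)
  have hπ : ∀ v, π v = (∑ i, d i)⁻¹ * (d ⬝ᵥ v) := fun v => rfl
  -- Scaling by `√d` turns the Euclidean norm into the weighted one.
  let φ : (Fin n → ℝ) →L[ℝ] EuclideanSpace ℝ (Fin n) := LinearMap.toContinuousLinearMap
    ((WithLp.linearEquiv 2 ℝ (Fin n → ℝ)).symm.toLinearMap ∘ₗ
      Matrix.mulVecLin (Matrix.diagonal fun i => √(d i)))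
  have hφ : ∀ v i, φ v i = √(d i) * v i := fun v i => by
    simp [φ, Matrix.mulVec_diagonal]
  have hφn : ∀ v, ‖φ v‖ ^ 2 = ∑ i, d i * v i ^ 2 := fun v => by
    rw [EuclideanSpace.norm_sq_eq]
    refine Finset.sum_congr rfl fun i _ => ?_
    rw [hφ, Real.norm_eq_abs, sq_abs, mul_pow, Real.sq_sqrt (hdpos i).le]
  have hφi : Function.Injective φ := fun u v huv => by
    ext i
    have := congrArg (fun w => w i) huv
    simp only [hφ] at this
    exact mul_left_cancel₀ (Real.sqrt_pos.2 (hdpos i)).ne' this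
  have hπ1 : π 1 = 1 := by
    rw [hπ, dotProduct_one]
    exact inv_mul_cancel₀ hsum.ne'
  obtain ⟨T, hT, N, C, hC, hN, h⟩ := exists_contracting_functional φ hφi π 1 hπ1
    (LinearMap.toContinuousLinearMap (Matrix.mulVecLin W))
    (LinearMap.toContinuousLinearMap (Matrix.mulVecLin (W * (Aᵀ * A)))) hW1
    (fun v => by
      rw [hπ, hπ]
      exact congrArg _ (hdW' v))
    (fun y hy hy0 => by
      refine lt_of_pow_lt_pow_left₀ 2 (norm_nonneg _) ?_
      rw [hφn, hφn]
      refine (weighted_sq_normalized_le hK hpsd hs y (W *ᵥ y) (hdWv y)).trans_lt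
        (hK.quadratic_lt hs y ?_)
      -- A constant vector of weighted mean zero vanishes.
      by_contra! hcon
      obtain ⟨i₀⟩ := hn
      have hyc : y = y i₀ • 1 := by
        ext i
        simp [hcon i i₀]
      rw [hyc, map_smul, hπ1, smul_eq_mul, mul_one] at hy
      exact hy0 (by rw [hyc, hy, zero_smul]))
    (by
      rw [hπ]
      refine mul_pos (inv_pos.2 hsum) ?_
      change 0 < d ⬝ᵥ ((W * (Aᵀ * A)) *ᵥ 1)
      rw [← Matrix.mulVec_mulVec, hdW']
      exact sum_mul_gram_mulVec_one_pos hA.nonneg hA0 d hdpos)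
  refine ⟨T, hT, fun t ht htT b x hx => ?_⟩
  obtain ⟨q, hq0, hq1, hq⟩ := h t ht htT
  refine exists_tendsto_of_affine_contraction (fun v => pnpMatrix W (Aᵀ * A) t *ᵥ v)
    (fun u v => Matrix.mulVec_sub _ u v) N C q hC hN hq0 hq1 (fun v => ?_) _ x hx
  have hP : pnpMatrix W (Aᵀ * A) t *ᵥ v = W *ᵥ v - t • ((W * (Aᵀ * A)) *ᵥ v) := by
    rw [pnpMatrix, Matrix.mul_sub, Matrix.mul_one, Matrix.mul_smul, Matrix.sub_mulVec,
      Matrix.smul_mulVec]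
  change N (pnpMatrix W (Aᵀ * A) t *ᵥ v) ≤ q * N v
  rw [hP]
  exact hq v
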